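/- For a set $X$ let $\mathcal D X$ be the set of finitely supported probability distributions on $X$, with $\mathcal D f(d)(y)=\sum_{x\in f^{-1}(y)}d(x)$ for $f\colon X\to Y$, and let $\delta_x$ be the point mass at $x$. For $S\subseteq\mathcal D X$ let $\mathrm{conv}(S)$ be the set of all finite convex combinations $\sum_i\alpha_i d_i$ with $d_i\in S$, $\alpha_i\ge 0$, $\sum_i\alpha_i=1$. Let $C$ be the monad on the category of sets for which $CX$ is the set of non-empty, finitely generated convex subsets of $\mathcal D X$ (the non-empty sets $\mathrm{conv}(F)$ with $F\subseteq\mathcal D X$ finite), $Cf(S)=\{\mathcal D f(d)\mid d\in S\}$, the unit is $\eta(x)=\{\delta_x\}$, and the multiplication is $$\mu(S)=\bigcup_{\Phi\in S}\Big\{\sum_{U\in\mathrm{supp}\,\Phi}\Phi(U)\cdot d_U \;\Big|\; d_U\in U \text{ for all } U\in\mathrm{supp}\,\Phi\Big\}\qquad(S\in CCX).$$ Let $(\Sigma,E)$ be the algebraic theory of convex semilattices: $\Sigma$ consists of a binary operation $\oplus$ and a binary operation $+_p$ for each $p\in(0,1)$, and $E$ consists of the axioms, for all $p,q\in(0,1)$,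 $$(x\oplus y)\oplus z=x\oplus(y\oplus z),\qquad x\oplus y=y\oplus x,\qquad x\oplus x=x,$$ $$(x+_q y)+_p z=x+_{pq}\big(y+_{\frac{p(1-q)}{1-pq}}z\big),\qquad x+_p y=y+_{1-p}x,\qquad x+_p x=x,$$ $$(x\oplus y)+_p z=(x+_p z)\oplus(y+_p z).$$ Let $T_{\Sigma,E}$ be the monad that maps $X$ to the set of $\Sigma$-terms with variables in $X$ modulo the smallest congruence $=_E$ containing all substitution instances of $E$, with variables as unit and substitution of terms as multiplication; $[t]_E$ denotes the class of $t$. **Theorem.** $(\Sigma,E)$ is a presentation of the monad $C$, that is, the monads $T_{\Sigma,E}$ and $C$ are isomorphic. More precisely, there is exactly one monad map $\iota\colon T_{\Sigma,E}\Rightarrow C$ such that, for every set $X$, all $x\in X$, all $\Sigma$-terms $t_1,t_2$ over $X$ and all $p\in(0,1)$, $$\iota_X[x]_E=\{\delta_x\},\qquad \iota_X[t_1\oplus t_2]_E=\mathrm{conv}\big(\iota_X[t_1]_E\cup\iota_X[t_2]_E\big),$$ $$\iota_X[t_1+_p t_2]_E=\{p\,d_1+(1-p)\,d_2\mid d_1\in\iota_X[t_1]_E,\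 d_2\in\iota_X[t_2]_E\},$$ and this $\iota$ is an isomorphism of monads. -/

import Mathlib

open CategoryTheory
open scoped Pointwise

universe u v w

namespace ConvPresentation

/-! ### Algebraic theories and their term monads -/

/-- An algebraic theory `(Σ, E)`: a signature `Σ` (only the function symbols of the language are
used) and a set `E` of equations between `Σ`-terms over countably many variables. -/
structure AlgTheory where
  sig : FirstOrder.Language.{0, 0}
  eqs : Set (sig.Term ℕ × sig.Term ℕ)

/-- `E.Eqv` is the relation `=_E` on terms over `X`: the smallest congruence that contains all
substitution instances of the equations. -/
inductive AlgTheory.Eqv (E : AlgTheory) {X : Type u} : E.sig.Term X → E.sig.Term X → Prop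
  | ax {l r : E.sig.Term ℕ} (h : (l, r) ∈ E.eqs) (σ : ℕ → E.sig.Term X) :
      Eqv E (l.subst σ) (r.subst σ)
  | refl (t : E.sig.Term X) : Eqv E t t
  | symm {s t : E.sig.Term X} : Eqv E s t → Eqv E t s
  | trans {s t r : E.sig.Term X} : Eqv E s t → Eqv E t r → Eqv E s r
  | congr {n : ℕ} (f : E.sig.Functions n) (ts ts' : Fin n → E.sig.Term X) :
      (∀ i, Eqv E (ts i) (ts' i)) → Eqv E (FirstOrder.Language.Term.func f ts) (FirstOrder.Language.Term.func f ts')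

theorem subst_subst {L : FirstOrder.Language.{0, 0}} {X : Type u} {Y : Type v} {Z : Type w} (t : L.Term X)
    (σ : X → L.Term Y) (τ : Y → L.Term Z) :
    (t.subst σ).subst τ = t.subst (fun x => (σ x).subst τ) := by
  induction t with
  | var x => rfl
  | func f ts ih => simp only [FirstOrder.Language.Term.subst]; congr 1; funext i; exact ih i

theorem subst_var {L : FirstOrder.Language.{0, 0}} {X : Type u} (t : L.Term X) :
    t.subst (fun x => FirstOrder.Language.Term.var x) = t := by
  induction t with
  | var x => rfl
  | func f ts ih => simp only [FirstOrder.Language.Term.subst]; congr 1; funext i; exact ih i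

namespace AlgTheory

variable (E : AlgTheory)

theorem Eqv.subst_left {E : AlgTheory} {X : Type u} {Y : Type v} {s t : E.sig.Term X}
    (h : E.Eqv s t) (σ : X → E.sig.Term Y) : E.Eqv (s.subst σ) (t.subst σ) := by
  induction h with
  | ax h τ => rw [subst_subst, subst_subst]; exact Eqv.ax h _
  | refl t => exact Eqv.refl _
  | symm _ ih => exact ih.symm
  | trans _ _ ih₁ ih₂ => exact ih₁.trans ih₂
  | congr f ts ts' _ ih => exact Eqv.congr f _ _ ih

theorem Eqv.subst_right {E : AlgTheory} {X : Type u} {Y : Type v} (t : E.sig.Term X)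
    {σ τ : X → E.sig.Term Y} (h : ∀ x, E.Eqv (σ x) (τ x)) : E.Eqv (t.subst σ) (t.subst τ) := by
  induction t with
  | var x => exact h x
  | func f ts ih => exact Eqv.congr f _ _ ih

def setoid (X : Type u) : Setoid (E.sig.Term X) where
  r := E.Eqv
  iseqv := ⟨Eqv.refl, Eqv.symm, Eqv.trans⟩

/-- `T_{Σ,E}(X)`: the set of `=_E`-classes of `Σ`-terms with variables in `X`. -/
def Cls (X : Type u) : Type u := Quotient (E.setoid X)

/-- The class `[t]_E` of a term `t`. -/
def cls {X : Type u} (t : E.sig.Term X) : E.Cls X := Quotient.mk (E.setoid X) t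

theorem cls_eq {X : Type u} {s t : E.sig.Term X} : E.cls s = E.cls t ↔ E.Eqv s t :=
  ⟨fun h => Quotient.exact h, fun h => Quotient.sound (s := E.setoid X) h⟩

/-- Action on functions: `[t]_E ↦ [t{f(x)/x}]_E`. -/
def Cls.map {X : Type u} {Y : Type v} (f : X → Y) : E.Cls X → E.Cls Y :=
  Quotient.lift (fun t => E.cls (t.subst fun x => FirstOrder.Language.Term.var (f x)))
    (fun _ _ h => (E.cls_eq).2 (Eqv.subst_left h _))

/-- Multiplication: `[t{[tᵢ]_E/xᵢ}]_E ↦ [t{tᵢ/xᵢ}]_E`, see `Cls.join_cls_subst`. -/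
noncomputable def Cls.join {X : Type u} : E.Cls (E.Cls X) → E.Cls X :=
  Quotient.lift (fun t => E.cls (t.subst fun c => Quotient.out (s := E.setoid X) c))
    (fun _ _ h => (E.cls_eq).2 (Eqv.subst_left h _))

theorem Cls.map_cls {X : Type u} {Y : Type v} (f : X → Y) (t : E.sig.Term X) :
    Cls.map E f (E.cls t) = E.cls (t.subst fun x => FirstOrder.Language.Term.var (f x)) := rfl

theorem out_eqv {X : Type u} (t : E.sig.Term X) :
    E.Eqv (Quotient.out (s := E.setoid X) (E.cls t)) t :=
  Quotient.mk_out (s := E.setoid X) t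

/-- For a term `t` over `V` and terms `tᵥ` over `X`, the class of `t{[tᵥ]_E/v}` is mapped to the
class of `t{tᵥ/v}`. -/
theorem Cls.join_cls_subst {V : Type v} {X : Type u} (t : E.sig.Term V) (s : V → E.sig.Term X) :
    Cls.join E (E.cls (t.subst fun x => FirstOrder.Language.Term.var (E.cls (s x)))) = E.cls (t.subst s) := by
  show E.cls _ = _
  rw [subst_subst, cls_eq]
  exact Eqv.subst_right t fun x => E.out_eqv (s x)

theorem exists_rep {X : Type u} (c : E.Cls X) : ∃ t, E.cls t = c := Quotient.exists_rep c

theorem exists_rep₂ {X : Type u} (c : E.Cls (E.Cls X)) :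
    ∃ t : E.sig.Term (E.sig.Term X),
      E.cls (t.subst fun s => FirstOrder.Language.Term.var (E.cls s)) = c := by
  obtain ⟨t, rfl⟩ := E.exists_rep c
  refine ⟨t.subst fun c => FirstOrder.Language.Term.var (Quotient.out (s := E.setoid X) c), ?_⟩
  rw [subst_subst]
  have : ∀ c : E.Cls X, E.cls (Quotient.out (s := E.setoid X) c) = c := fun c => Quotient.out_eq c
  simp only [FirstOrder.Language.Term.subst, this, subst_var]

theorem Cls.map_id {X : Type u} (c : E.Cls X) : Cls.map E id c = c := by
  obtain ⟨t, rfl⟩ := E.exists_rep c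
  exact congrArg E.cls (subst_var t)

theorem Cls.map_comp {X : Type u} {Y : Type v} {Z : Type w} (f : X → Y) (g : Y → Z) (c : E.Cls X) :
    Cls.map E (g ∘ f) c = Cls.map E g (Cls.map E f c) := by
  obtain ⟨t, rfl⟩ := E.exists_rep c
  exact (congrArg E.cls (subst_subst t (fun x => FirstOrder.Language.Term.var (f x))
    (fun y => FirstOrder.Language.Term.var (g y)))).symm

theorem Cls.join_map {X : Type u} {Y : Type v} (f : X → Y) (c : E.Cls (E.Cls X)) :
    Cls.join E (Cls.map E (Cls.map E f) c) = Cls.map E f (Cls.join E c) := by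
  obtain ⟨t, rfl⟩ := E.exists_rep₂ c
  rw [Cls.join_cls_subst, Cls.map_cls, Cls.map_cls, subst_subst, subst_subst]
  exact Cls.join_cls_subst E t _

theorem Cls.join_join {X : Type u} (c : E.Cls (E.Cls (E.Cls X))) :
    Cls.join E (Cls.map E (Cls.join E) c) = Cls.join E (Cls.join E c) := by
  obtain ⟨t, rfl⟩ := E.exists_rep₂ c
  rw [Cls.join_cls_subst, Cls.map_cls, subst_subst]
  show Cls.join E (E.cls (t.subst fun x => FirstOrder.Language.Term.var (E.cls _))) = E.cls _
  rw [Cls.join_cls_subst, subst_subst]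

theorem Cls.join_var {X : Type u} (c : E.Cls X) :
    Cls.join E (E.cls (FirstOrder.Language.Term.var c)) = c :=
  Quotient.out_eq c

theorem Cls.join_map_var {X : Type u} (c : E.Cls X) :
    Cls.join E (Cls.map E (fun x => E.cls (FirstOrder.Language.Term.var x)) c) = c := by
  obtain ⟨t, rfl⟩ := E.exists_rep c
  rw [Cls.map_cls, Cls.join_cls_subst, subst_var]

/-- The monad `T_{Σ,E}` on the category of sets. -/
noncomputable def termMonad : CategoryTheory.Monad (Type u) where
  obj X := E.Cls X
  map f := TypeCat.ofHom (Cls.map E f)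
  map_id _ := ConcreteCategory.hom_ext _ _ (Cls.map_id E)
  map_comp f g := ConcreteCategory.hom_ext _ _ (Cls.map_comp E f g)
  η :=
    { app := fun X => TypeCat.ofHom fun x => E.cls (FirstOrder.Language.Term.var x)
      naturality := fun _ _ _ => rfl }
  μ :=
    { app := fun X => TypeCat.ofHom (Cls.join E)
      naturality := fun _ _ f => ConcreteCategory.hom_ext _ _ (Cls.join_map E f) }
  assoc _ := ConcreteCategory.hom_ext _ _ (Cls.join_join E)
  left_unit _ := ConcreteCategory.hom_ext _ _ (Cls.join_var E)
  right_unit _ := ConcreteCategory.hom_ext _ _ (Cls.join_map_var E)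

/-- `(Σ, E)` is a presentation of the monad `T`: there is an isomorphism of monads
`T_{Σ,E} ≅ T`. -/
def IsPresentationOf (T : CategoryTheory.Monad (Type u)) : Prop :=
  Nonempty (E.termMonad ≅ T)

end AlgTheory

/-! ### The theory of convex semilattices -/

/-- The open unit interval `(0,1)`. -/
abbrev OpenUnit : Type := Set.Ioo (0 : ℝ) 1

/-- Operation symbols: a binary `⊕` and a binary `+_p` for every `p ∈ (0,1)`. -/
inductive CSOp : ℕ → Type
  | oplus : CSOp 2
  | cplus (p : OpenUnit) : CSOp 2

/-- The signature of convex semilattices. -/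
def csSig : FirstOrder.Language.{0, 0} where
  Functions := CSOp
  Relations := fun _ => Empty

/-- The term `s ⊕ t`. -/
def tOplus {X : Type u} (s t : csSig.Term X) : csSig.Term X :=
  FirstOrder.Language.Term.func (L := csSig) CSOp.oplus ![s, t]

/-- The term `s +_p t`. -/
def tCplus {X : Type u} (p : OpenUnit) (s t : csSig.Term X) : csSig.Term X :=
  FirstOrder.Language.Term.func (L := csSig) (CSOp.cplus p) ![s, t]

/-- The variable `x` of the axioms (`vy`, `vz` below are `y`, `z`). -/
def vx : csSig.Term ℕ := FirstOrder.Language.Term.var 0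
def vy : csSig.Term ℕ := FirstOrder.Language.Term.var 1
def vz : csSig.Term ℕ := FirstOrder.Language.Term.var 2

/-- The axioms of convex semilattices. In `assocP` the weights on the right-hand side are
`r = p q` and `s = p (1 - q) / (1 - p q)`; in `commP`, `q = 1 - p`. -/
inductive CSAx : csSig.Term ℕ × csSig.Term ℕ → Prop
  | assoc : CSAx (tOplus (tOplus vx vy) vz, tOplus vx (tOplus vy vz))
  | comm : CSAx (tOplus vx vy, tOplus vy vx)
  | idem : CSAx (tOplus vx vx, vx)
  | assocP (p q r s : OpenUnit) (hr : (r : ℝ) = p * q) (hs : (s : ℝ) = p * (1 - q) / (1 - p * q)) :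
      CSAx (tCplus p (tCplus q vx vy) vz, tCplus r vx (tCplus s vy vz))
  | commP (p q : OpenUnit) (hq : (q : ℝ) = 1 - p) : CSAx (tCplus p vx vy, tCplus q vy vx)
  | idemP (p : OpenUnit) : CSAx (tCplus p vx vx, vx)
  | distrib (p : OpenUnit) :
      CSAx (tCplus p (tOplus vx vy) vz, tOplus (tCplus p vx vz) (tCplus p vy vz))

/-- The algebraic theory of convex semilattices. -/
def convexSemilattices : AlgTheory where
  sig := csSig
  eqs := {e | CSAx e}

/-! ### Convex sets of distributions -/

/-- Finitely supported probability distributions on `X`. -/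
abbrev FDist (X : Type u) : Type u := Convexity.StdSimplex ℝ X

/-- The convex closure: all finite convex combinations `∑ᵢ αᵢ dᵢ` of members `dᵢ` of `S` (with
`αᵢ ≥ 0`, `∑ᵢ αᵢ = 1`). -/
def conv {X : Type u} (S : Set (FDist X)) : Set (FDist X) :=
  {d | ∃ α : FDist (FDist X), ↑α.weights.support ⊆ S ∧
    d.weights = ∑ e ∈ α.weights.support, α.weights e • e.weights}

/-- `C X`: the non-empty, finitely generated convex subsets of `FDist X`. (A set of the form
`conv F` is convex, i.e. equal to its convex closure, see `ConvSet.conv_carrier`.) -/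
@[ext]
structure ConvSet (X : Type u) where
  carrier : Set (FDist X)
  nonempty : carrier.Nonempty
  fg : ∃ F : Set (FDist X), F.Finite ∧ carrier = conv F

theorem mem_conv_iff {X : Type u} {S : Set (FDist X)} {d : FDist X} :
    d ∈ conv S ↔ d.weights ∈ convexHull ℝ (Convexity.StdSimplex.weights '' S) := by
  constructor
  · rintro ⟨α, hα, h⟩
    rw [h]
    refine (convex_convexHull ℝ _).sum_mem (fun e _ => α.nonneg e) α.total fun e he => ?_
    exact subset_convexHull ℝ _ ⟨e, hα he, rfl⟩
  · intro h
    have key : convexHull ℝ (Convexity.StdSimplex.weights '' S) ⊆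
        {v | ∃ α : FDist (FDist X), ↑α.weights.support ⊆ S ∧
          v = α.weights.sum fun e r => r • e.weights} := by
      refine convexHull_min ?_ ?_
      · rintro _ ⟨e, he, rfl⟩
        refine ⟨Convexity.StdSimplex.single e, ?_, by simp⟩
        intro x hx
        have := Finsupp.support_single_subset hx
        simp only [Finset.mem_singleton] at this
        exact this ▸ he
      · rintro _ ⟨α, hα, rfl⟩ _ ⟨β, hβ, rfl⟩ a b ha hb hab
        refine ⟨⟨a • α.weights + b • β.weights, ?_, ?_⟩, ?_, ?_⟩
        · exact add_nonneg (smul_nonneg ha α.nonneg) (smul_nonneg hb β.nonneg)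
        · rw [Finsupp.sum_add_index' (by simp) (by simp), Finsupp.sum_smul_index (by simp),
            Finsupp.sum_smul_index (by simp), ← Finsupp.mul_sum, ← Finsupp.mul_sum, α.total,
            β.total, mul_one, mul_one, hab]
        · intro x hx
          by_contra hxS
          have h1 : α.weights x = 0 := by
            by_contra h0
            exact hxS (hα (Finsupp.mem_support_iff.2 h0))
          have h2 : β.weights x = 0 := by
            by_contra h0
            exact hxS (hβ (Finsupp.mem_support_iff.2 h0))
          simp [h1, h2] at hx
        · rw [Finsupp.sum_add_index' (by simp) (by simp [add_smul]),
            Finsupp.sum_smul_index (by simp), Finsupp.sum_smul_index (by simp),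
            Finsupp.smul_sum, Finsupp.smul_sum]
          simp [mul_smul]
    obtain ⟨α, hα, e⟩ := key h
    exact ⟨α, hα, e⟩

/-- The set of weight vectors of a set of distributions, in the vector space `X →₀ ℝ`. -/
def wt {X : Type u} (S : Set (FDist X)) : Set (X →₀ ℝ) := Convexity.StdSimplex.weights '' S

theorem wt_injective {X : Type u} : Function.Injective (wt (X := X)) :=
  Set.image_injective.2 fun _ _ h => Convexity.StdSimplex.weights_inj.1 h

theorem mem_wt {X : Type u} {S : Set (FDist X)} {d : FDist X} : d.weights ∈ wt S ↔ d ∈ S :=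
  Function.Injective.mem_set_image fun _ _ h => Convexity.StdSimplex.weights_inj.1 h

theorem convex_simplex (X : Type u) : Convex ℝ (wt (Set.univ : Set (FDist X))) := by
  rintro _ ⟨α, -, rfl⟩ _ ⟨β, -, rfl⟩ a b ha hb hab
  refine ⟨⟨a • α.weights + b • β.weights, ?_, ?_⟩, trivial, rfl⟩
  · exact add_nonneg (smul_nonneg ha α.nonneg) (smul_nonneg hb β.nonneg)
  · rw [Finsupp.sum_add_index' (by simp) (by simp), Finsupp.sum_smul_index (by simp),
      Finsupp.sum_smul_index (by simp), ← Finsupp.mul_sum, ← Finsupp.mul_sum, α.total,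
      β.total, mul_one, mul_one, hab]

theorem wt_conv {X : Type u} (S : Set (FDist X)) : wt (conv S) = convexHull ℝ (wt S) := by
  ext v
  constructor
  · rintro ⟨d, hd, rfl⟩
    exact mem_conv_iff.1 hd
  · intro hv
    obtain ⟨d, -, rfl⟩ := convexHull_min (Set.image_mono (Set.subset_univ S)) (convex_simplex X) hv
    exact ⟨d, mem_conv_iff.2 hv, rfl⟩

namespace ConvSet

theorem convex_wt {X : Type u} (S : ConvSet X) : Convex ℝ (wt S.carrier) := by
  obtain ⟨F, -, h⟩ := S.fg
  rw [h, wt_conv]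
  exact convex_convexHull ℝ _

theorem conv_carrier {X : Type u} (S : ConvSet X) : conv S.carrier = S.carrier :=
  wt_injective <| by rw [wt_conv, S.convex_wt.convexHull_eq]

theorem wt_nonempty {X : Type u} (S : ConvSet X) : (wt S.carrier).Nonempty := S.nonempty.image _

/-- Action on functions: `Cf(S) = {Df(d) | d ∈ S}`. -/
def map {X : Type u} {Y : Type v} (f : X → Y) (S : ConvSet X) : ConvSet Y where
  carrier := Convexity.StdSimplex.map f '' S.carrier
  nonempty := S.nonempty.image _
  fg := by
    obtain ⟨F, hF, h⟩ := S.fg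
    refine ⟨Convexity.StdSimplex.map f '' F, hF.image _, wt_injective ?_⟩
    have key : ∀ A : Set (FDist X), wt (Convexity.StdSimplex.map f '' A) =
        Finsupp.lmapDomain ℝ ℝ f '' wt A := by
      intro A
      simp only [wt, Set.image_image]
      rfl
    rw [key, h, wt_conv, wt_conv, key, LinearMap.image_convexHull]

/-- Unit: `x ↦ {δ_x}`. -/
def pure {X : Type u} (x : X) : ConvSet X where
  carrier := {Convexity.StdSimplex.single x}
  nonempty := Set.singleton_nonempty _
  fg := ⟨{Convexity.StdSimplex.single x}, Set.finite_singleton _, wt_injective (by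
    rw [wt_conv, wt, Set.image_singleton, convexHull_singleton])⟩

/-- The underlying set of the multiplication:
`⋃_{Φ ∈ S} {∑_{U ∈ supp Φ} Φ(U) • d_U | d_U ∈ U}`. -/
def joinCarrier {X : Type u} (S : Set (FDist (ConvSet X))) : Set (FDist X) :=
  {d | ∃ Φ ∈ S, ∃ f : ConvSet X → FDist X, (∀ U ∈ Φ.weights.support, f U ∈ U.carrier) ∧
    d.weights = ∑ U ∈ Φ.weights.support, Φ.weights U • (f U).weights}

/-- Minkowski combination `∑_U Φ(U) • U` of weight vectors. -/
noncomputable def mink {X : Type u} (Φ : ConvSet X →₀ ℝ) : Set (X →₀ ℝ) :=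
  ∑ U ∈ Φ.support, Φ U • wt U.carrier

theorem mink_eq {X : Type u} (Φ : ConvSet X →₀ ℝ) {T : Finset (ConvSet X)} (h : Φ.support ⊆ T) :
    mink Φ = ∑ U ∈ T, Φ U • wt U.carrier := by
  refine Finset.sum_subset h fun U _ hU => ?_
  rw [Finsupp.notMem_support_iff.1 hU, Set.zero_smul_set U.wt_nonempty]

theorem mink_add {X : Type u} {Φ Ψ : ConvSet X →₀ ℝ} (hΦ : 0 ≤ Φ) (hΨ : 0 ≤ Ψ) :
    mink (Φ + Ψ) = mink Φ + mink Ψ := by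
  classical
  rw [mink_eq (Φ + Ψ) Finsupp.support_add, mink_eq Φ Finset.subset_union_left,
    mink_eq Ψ Finset.subset_union_right, ← Finset.sum_add_distrib]
  exact Finset.sum_congr rfl fun U _ => U.convex_wt.add_smul (hΦ U) (hΨ U)

theorem mink_zero {X : Type u} : mink (0 : ConvSet X →₀ ℝ) = 0 := by simp [mink]

theorem mink_single {X : Type u} (U : ConvSet X) (r : ℝ) :
    mink (Finsupp.single U r) = r • wt U.carrier := by
  rw [mink_eq _ Finsupp.support_single_subset]
  simp

theorem mink_smul {X : Type u} (Φ : ConvSet X →₀ ℝ) (r : ℝ) : mink (r • Φ) = r • mink Φ := by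
  rw [mink_eq (r • Φ) Finsupp.support_smul, mink, Finset.smul_sum]
  exact Finset.sum_congr rfl fun U _ => by rw [Finsupp.smul_apply, smul_eq_mul, mul_smul]

theorem mink_sum {X : Type u} {ι : Type v} (s : Finset ι) (Φ : ι → ConvSet X →₀ ℝ)
    (h : ∀ i, 0 ≤ Φ i) : mink (∑ i ∈ s, Φ i) = ∑ i ∈ s, mink (Φ i) := by
  classical
  induction s using Finset.induction_on with
  | empty => simp [mink_zero]
  | insert i s hi ih =>
    rw [Finset.sum_insert hi, Finset.sum_insert hi, mink_add (h i)
      (Finset.sum_nonneg fun j _ => h j), ih]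

theorem mink_mapDomain {X : Type u} {ι : Type v} (g : ι → ConvSet X) (α : ι →₀ ℝ) (h : 0 ≤ α) :
    mink (α.mapDomain g) = ∑ i ∈ α.support, α i • wt (g i).carrier := by
  rw [Finsupp.mapDomain, Finsupp.sum, mink_sum _ _ fun i => Finsupp.single_nonneg.2 (h i)]
  exact Finset.sum_congr rfl fun i _ => mink_single _ _

theorem mem_mink {X : Type u} (Φ : ConvSet X →₀ ℝ) (v : X →₀ ℝ) :
    v ∈ mink Φ ↔ ∃ f : ConvSet X → FDist X, (∀ U ∈ Φ.support, f U ∈ U.carrier) ∧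
      v = ∑ U ∈ Φ.support, Φ U • (f U).weights := by
  rw [mink, Set.mem_finsetSum]
  constructor
  · rintro ⟨g, hg, rfl⟩
    have : ∀ U : ConvSet X, ∃ d : FDist X, d ∈ U.carrier ∧
        (U ∈ Φ.support → g U = Φ U • d.weights) := by
      intro U
      by_cases hU : U ∈ Φ.support
      · obtain ⟨_, ⟨d, hd, rfl⟩, e⟩ := hg hU
        exact ⟨d, hd, fun _ => e.symm⟩
      · exact ⟨U.nonempty.some, U.nonempty.some_mem, fun h => absurd h hU⟩
    choose f hf hf' using this
    exact ⟨f, fun U _ => hf U, Finset.sum_congr rfl hf'⟩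
  · rintro ⟨f, hf, rfl⟩
    exact ⟨fun U => Φ U • (f U).weights,
      fun {U} hU => Set.smul_mem_smul_set (mem_wt.2 (hf U hU)), rfl⟩

theorem mink_subset {X : Type u} (Φ : FDist (ConvSet X)) :
    mink Φ.weights ⊆ wt (Set.univ : Set (FDist X)) := by
  intro v hv
  obtain ⟨f, -, rfl⟩ := (mem_mink _ _).1 hv
  exact (convex_simplex X).sum_mem (fun U _ => Φ.nonneg U) Φ.total fun U _ => ⟨f U, trivial, rfl⟩

theorem mink_nonempty {X : Type u} (Φ : ConvSet X →₀ ℝ) : (mink Φ).Nonempty := by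
  refine ⟨_, (mem_mink _ _).2 ⟨fun U => U.nonempty.some, fun U _ => U.nonempty.some_mem, rfl⟩⟩

theorem wt_joinCarrier {X : Type u} (S : Set (FDist (ConvSet X))) :
    wt (joinCarrier S) = ⋃ Φ ∈ wt S, mink Φ := by
  ext v
  simp only [Set.mem_iUnion, exists_prop]
  constructor
  · rintro ⟨d, ⟨Φ, hΦ, f, hf, e⟩, rfl⟩
    exact ⟨Φ.weights, ⟨Φ, hΦ, rfl⟩, (mem_mink _ _).2 ⟨f, hf, e⟩⟩
  · rintro ⟨_, ⟨Φ, hΦ, rfl⟩, hv⟩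
    obtain ⟨d, -, rfl⟩ := mink_subset Φ hv
    obtain ⟨f, hf, e⟩ := (mem_mink _ _).1 hv
    exact ⟨d, ⟨Φ, hΦ, f, hf, e⟩, rfl⟩

theorem nonneg_of_mem_wt {X : Type u} {S : Set (FDist X)} {v : X →₀ ℝ} (h : v ∈ wt S) : 0 ≤ v := by
  obtain ⟨d, -, rfl⟩ := h
  exact d.nonneg

theorem mink_comb {X : Type u} {Φ Ψ : ConvSet X →₀ ℝ} (hΦ : 0 ≤ Φ) (hΨ : 0 ≤ Ψ) {a b : ℝ}
    (ha : 0 ≤ a) (hb : 0 ≤ b) : mink (a • Φ + b • Ψ) = a • mink Φ + b • mink Ψ := by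
  rw [mink_add (smul_nonneg ha hΦ) (smul_nonneg hb hΨ), mink_smul, mink_smul]

/-- Multiplication of the monad `C`. -/
def join {X : Type u} (S : ConvSet (ConvSet X)) : ConvSet X where
  carrier := joinCarrier S.carrier
  nonempty := by
    obtain ⟨Φ, hΦ⟩ := S.wt_nonempty
    obtain ⟨v, hv⟩ := mink_nonempty Φ
    have : v ∈ wt (joinCarrier S.carrier) := by
      rw [wt_joinCarrier]
      exact Set.mem_biUnion hΦ hv
    obtain ⟨d, hd, -⟩ := this
    exact ⟨d, hd⟩
  fg := by
    classical
    obtain ⟨F, hF, hS⟩ := S.fg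
    choose G hGfin hG using fun U : ConvSet X => U.fg
    -- finite generating set, as weight vectors
    set B : Set (X →₀ ℝ) := ⋃ Φ ∈ F, ∑ U ∈ Φ.weights.support, Φ.weights U • wt (G U) with hB
    have hmink : ∀ Φ : FDist (ConvSet X), mink Φ.weights =
        convexHull ℝ (∑ U ∈ Φ.weights.support, Φ.weights U • wt (G U)) := by
      intro Φ
      rw [convexHull_sum, mink]
      refine Finset.sum_congr rfl fun U _ => ?_
      conv_lhs => rw [hG U, wt_conv]
      rw [convexHull_smul]
    have hBfin : B.Finite := by
      refine hF.biUnion fun Φ _ => ?_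
      refine Finset.sum_induction _ Set.Finite (fun _ _ h₁ h₂ => h₁.add h₂) Set.finite_zero ?_
      intro U _
      exact ((hGfin U).image _).image _
    have hBsub : B ⊆ wt (Set.univ : Set (FDist X)) := by
      refine Set.iUnion₂_subset fun Φ _ => ?_
      refine Set.Subset.trans ?_ (mink_subset Φ)
      rw [hmink]
      exact subset_convexHull ℝ _
    refine ⟨{d | d.weights ∈ B}, ?_, wt_injective ?_⟩
    · exact hBfin.preimage fun _ _ _ _ h => Convexity.StdSimplex.weights_inj.1 h
    · have hwB : wt {d : FDist X | d.weights ∈ B} = B := by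
        ext v
        constructor
        · rintro ⟨d, hd, rfl⟩
          exact hd
        · intro hv
          obtain ⟨d, -, rfl⟩ := hBsub hv
          exact ⟨d, hv, rfl⟩
      rw [wt_conv, hwB, wt_joinCarrier]
      apply Set.Subset.antisymm
      · have key : wt S.carrier ⊆ {Φ | 0 ≤ Φ ∧ mink Φ ⊆ convexHull ℝ B} := by
          rw [hS, wt_conv]
          refine convexHull_min ?_ ?_
          · rintro _ ⟨Φ, hΦ, rfl⟩
            refine ⟨Φ.nonneg, ?_⟩
            rw [hmink]
            exact convexHull_mono (Set.subset_biUnion_of_mem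
              (u := fun Φ : FDist (ConvSet X) =>
                ∑ U ∈ Φ.weights.support, Φ.weights U • wt (G U)) hΦ)
          · rintro Φ ⟨hΦ, hΦ'⟩ Ψ ⟨hΨ, hΨ'⟩ a b ha hb hab
            refine ⟨add_nonneg (smul_nonneg ha hΦ) (smul_nonneg hb hΨ), ?_⟩
            rw [mink_comb hΦ hΨ ha hb]
            exact (Set.add_subset_add (Set.smul_set_mono hΦ') (Set.smul_set_mono hΨ')).trans
              (convex_iff_pointwise_add_subset.1 (convex_convexHull ℝ B) ha hb hab)
        exact Set.iUnion₂_subset fun Φ hΦ => (key hΦ).2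
      · refine convexHull_min ?_ ?_
        · refine Set.iUnion₂_subset fun Φ hΦ => ?_
          have h1 : Φ.weights ∈ wt S.carrier := by
            rw [hS, wt_conv]
            exact subset_convexHull ℝ _ ⟨Φ, hΦ, rfl⟩
          refine Set.Subset.trans ?_ (Set.subset_biUnion_of_mem h1)
          rw [hmink]
          exact subset_convexHull ℝ _
        · intro v hv w hw a b ha hb hab
          simp only [Set.mem_iUnion, exists_prop] at hv hw ⊢
          obtain ⟨Φ, hΦ, hv⟩ := hv
          obtain ⟨Ψ, hΨ, hw⟩ := hw
          refine ⟨a • Φ + b • Ψ, S.convex_wt hΦ hΨ ha hb hab, ?_⟩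
          rw [mink_comb (nonneg_of_mem_wt hΦ) (nonneg_of_mem_wt hΨ) ha hb]
          exact Set.add_mem_add (Set.smul_mem_smul_set hv) (Set.smul_mem_smul_set hw)

theorem ext_wt {X : Type u} {S T : ConvSet X} (h : wt S.carrier = wt T.carrier) : S = T :=
  ConvSet.ext (wt_injective h)

theorem wt_map {X : Type u} {Y : Type v} (f : X → Y) (S : ConvSet X) :
    wt (S.map f).carrier = Finsupp.lmapDomain ℝ ℝ f '' wt S.carrier := by
  simp only [wt, map, Set.image_image]
  rfl

theorem wt_join {X : Type u} (S : ConvSet (ConvSet X)) :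
    wt S.join.carrier = ⋃ Φ ∈ wt S.carrier, mink Φ := wt_joinCarrier _

theorem wt_pure {X : Type u} (x : X) : wt (pure x).carrier = {Finsupp.single x 1} := by
  simp [wt, pure]

theorem map_id {X : Type u} (S : ConvSet X) : S.map id = S := by
  refine ext_wt ?_
  rw [wt_map, Finsupp.lmapDomain_id]
  simp

theorem map_comp {X : Type u} {Y : Type v} {Z : Type w} (f : X → Y) (g : Y → Z) (S : ConvSet X) :
    S.map (g ∘ f) = (S.map f).map g := by
  refine ext_wt ?_
  rw [wt_map, wt_map, wt_map, Finsupp.lmapDomain_comp, LinearMap.coe_comp, Set.image_comp]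

theorem map_pure {X : Type u} {Y : Type v} (f : X → Y) (x : X) : (pure x).map f = pure (f x) := by
  refine ext_wt ?_
  simp [wt_map, wt_pure]

theorem image_mink {X : Type u} {Y : Type v} (f : X → Y) (Φ : ConvSet X →₀ ℝ) (h : 0 ≤ Φ) :
    mink (Φ.mapDomain (map f)) = Finsupp.lmapDomain ℝ ℝ f '' mink Φ := by
  rw [mink_mapDomain _ _ h, mink, Set.image_finsetSum]
  refine Finset.sum_congr rfl fun U _ => ?_
  rw [wt_map, Set.image_smul_comm]
  intro b
  exact LinearMap.map_smul _ _ _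

theorem join_map {X : Type u} {Y : Type v} (f : X → Y) (S : ConvSet (ConvSet X)) :
    (S.map (map f)).join = S.join.map f := by
  refine ext_wt ?_
  rw [wt_join, wt_map, wt_map, wt_join, Set.biUnion_image, Set.image_iUnion₂]
  exact Set.iUnion₂_congr fun Φ hΦ => image_mink f Φ (nonneg_of_mem_wt hΦ)

theorem join_pure {X : Type u} (S : ConvSet X) : (pure S).join = S := by
  refine ext_wt ?_
  rw [wt_join, wt_pure, Set.biUnion_singleton, mink_single, one_smul]

theorem join_map_pure {X : Type u} (S : ConvSet X) : (S.map pure).join = S := by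
  refine ext_wt ?_
  rw [wt_join, wt_map, Set.biUnion_image]
  have : ∀ v ∈ wt S.carrier, mink (Finsupp.lmapDomain ℝ ℝ pure v) = {v} := by
    intro v hv
    rw [Finsupp.lmapDomain_apply, mink_mapDomain _ _ (nonneg_of_mem_wt hv)]
    simp only [wt_pure, Set.smul_set_singleton, Finsupp.smul_single, smul_eq_mul, mul_one]
    rw [Set.finsetSum_singleton]
    exact congrArg _ (Finsupp.sum_single v)
  rw [Set.iUnion₂_congr this]
  simp

theorem mink_join {X : Type u} (Φ : ConvSet (ConvSet X) →₀ ℝ) (h : 0 ≤ Φ) :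
    mink (Φ.mapDomain join) = ⋃ Ψ ∈ mink Φ, mink Ψ := by
  rw [mink_mapDomain _ _ h]
  ext v
  simp only [Set.mem_iUnion, exists_prop]
  constructor
  · intro hv
    obtain ⟨g, hg, rfl⟩ := (Set.mem_finsetSum _ _ _).1 hv
    have : ∀ W : ConvSet (ConvSet X), ∃ Θ ∈ wt W.carrier,
        (W ∈ Φ.support → g W ∈ Φ W • mink Θ) := by
      intro W
      by_cases hW : W ∈ Φ.support
      · have := hg hW
        rw [wt_join] at this
        obtain ⟨u, hu, e⟩ := this
        simp only [Set.mem_iUnion, exists_prop] at hu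
        obtain ⟨Θ, hΘ, hu⟩ := hu
        exact ⟨Θ, hΘ, fun _ => ⟨u, hu, e⟩⟩
      · exact ⟨_, W.wt_nonempty.some_mem, fun h => absurd h hW⟩
    choose Θ hΘ hΘ' using this
    refine ⟨∑ W ∈ Φ.support, Φ W • Θ W, ?_, ?_⟩
    · exact (Set.mem_finsetSum _ _ _).2 ⟨_, fun {W} _ => Set.smul_mem_smul_set (hΘ W), rfl⟩
    · rw [mink_sum _ _ fun W => smul_nonneg (h W) (nonneg_of_mem_wt (hΘ W))]
      refine (Set.mem_finsetSum _ _ _).2 ⟨g, fun {W} hW => ?_, rfl⟩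
      rw [mink_smul]
      exact hΘ' W hW
  · rintro ⟨Ψ, hΨ, hv⟩
    obtain ⟨f, hf, rfl⟩ := (mem_mink _ _).1 hΨ
    rw [mink_sum _ _ fun W => smul_nonneg (h W) (f W).nonneg] at hv
    obtain ⟨g, hg, rfl⟩ := (Set.mem_finsetSum _ _ _).1 hv
    refine (Set.mem_finsetSum _ _ _).2 ⟨g, fun {W} hW => ?_, rfl⟩
    have := hg hW
    rw [mink_smul] at this
    refine Set.smul_set_mono ?_ this
    rw [wt_join]
    exact Set.subset_biUnion_of_mem (u := fun Φ => mink Φ) (mem_wt.2 (hf W hW))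

theorem join_join {X : Type u} (S : ConvSet (ConvSet (ConvSet X))) :
    (S.map join).join = S.join.join := by
  refine ext_wt ?_
  rw [wt_join, wt_map, Set.biUnion_image, wt_join, wt_join]
  simp only [Finsupp.lmapDomain_apply]
  rw [Set.iUnion₂_congr fun Φ hΦ => mink_join Φ (nonneg_of_mem_wt hΦ)]
  ext v
  simp only [Set.mem_iUnion, exists_prop]
  constructor
  · rintro ⟨Φ, hΦ, Ψ, hΨ, hv⟩
    exact ⟨Ψ, ⟨Φ, hΦ, hΨ⟩, hv⟩
  · rintro ⟨Ψ, ⟨Φ, hΦ, hΨ⟩, hv⟩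
    exact ⟨Φ, hΦ, Ψ, hΨ, hv⟩

end ConvSet

/-- The monad `C` of non-empty, finitely generated convex sets of finitely supported
distributions. -/
def convMonad : CategoryTheory.Monad (Type u) where
  obj X := ConvSet X
  map f := TypeCat.ofHom (ConvSet.map f)
  map_id _ := ConcreteCategory.hom_ext _ _ ConvSet.map_id
  map_comp f g := ConcreteCategory.hom_ext _ _ (ConvSet.map_comp f g)
  η :=
    { app := fun X => TypeCat.ofHom ConvSet.pure
      naturality := fun _ _ f => ConcreteCategory.hom_ext _ _ fun x => (ConvSet.map_pure f x).symm }
  μ :=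
    { app := fun X => TypeCat.ofHom ConvSet.join
      naturality := fun _ _ f => ConcreteCategory.hom_ext _ _ (ConvSet.join_map f) }
  assoc _ := ConcreteCategory.hom_ext _ _ ConvSet.join_join
  left_unit _ := ConcreteCategory.hom_ext _ _ ConvSet.join_pure
  right_unit _ := ConcreteCategory.hom_ext _ _ ConvSet.join_map_pure

/-! ### The induced monad map -/

/-- Convex union `S₁ ⊕ S₂ = conv (S₁ ∪ S₂)`. -/
def convUnion {X : Type u} (S₁ S₂ : Set (FDist X)) : Set (FDist X) := conv (S₁ ∪ S₂)

/-- Minkowski sum `S₁ +_p S₂ = {p d₁ + (1 - p) d₂ | d₁ ∈ S₁, d₂ ∈ S₂}`. -/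
def minkowskiSum {X : Type u} (p : OpenUnit) (S₁ S₂ : Set (FDist X)) : Set (FDist X) :=
  {d | ∃ d₁ ∈ S₁, ∃ d₂ ∈ S₂, d.weights = (p : ℝ) • d₁.weights + (1 - (p : ℝ)) • d₂.weights}

/-- The value of a monad map `ι : T_{Σ,E} ⇒ C` at the class `[t]_E`, as a set of distributions. -/
def value (ι : convexSemilattices.termMonad ⟶ convMonad.{u}) {X : Type u} (t : csSig.Term X) :
    Set (FDist X) :=
  ConvSet.carrier (ι.app X (convexSemilattices.cls t))

/-- `ι` is the monad map induced by the convex semilattice structure on the sets `C X`: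
`ι[x] = {δ_x}`, `ι[s ⊕ t] = ι[s] ⊕ ι[t]` and `ι[s +_p t] = ι[s] +_p ι[t]`. -/
structure IsInduced (ι : convexSemilattices.termMonad ⟶ convMonad.{u}) : Prop where
  var : ∀ (X : Type u) (x : X),
    value ι (FirstOrder.Language.Term.var x) = {Convexity.StdSimplex.single x}
  oplus : ∀ (X : Type u) (s t : csSig.Term X),
    value ι (tOplus s t) = convUnion (value ι s) (value ι t)
  cplus : ∀ (X : Type u) (p : OpenUnit) (s t : csSig.Term X),
    value ι (tCplus p s t) = minkowskiSum p (value ι s) (value ι t)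

end ConvPresentation

/-!
# Convex semilattices present the monad of finitely generated convex sets of distributions

Both `T_{Σ,E} X` and `C X` are convex semilattices, so a term `t` over `X` denotes an element
`denote t` of `C X`, and by soundness (`Eqv.realize_eq`) this depends only on the class of `t`.
Since `C f` and the multiplication of `C` preserve both operations (`ConvSet.map_sup`,
`ConvSet.map_mix`, `ConvSet.join_sup`, `ConvSet.join_mix`), the denotation is a map of monads. It is
the only one that satisfies the three defining equations, by induction on terms. What remains is
that it is bijective at every set `X`.

*Surjectivity* (`denote_surjective`). The weight vectors `v` such that `{v}` is denoted by a term
form a convex set that contains all point masses, hence all distributions; finite unions of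
generators are obtained with `⊕`.

*Injectivity* (`eqv_of_denote_eq`). Let `A` be a convex semilattice and `v : X → A`. Every
distribution `d` on `X` has a barycentre `bary v d` in `A`. It is computed in the cone over `A`,
whose elements are `0` and the pairs of a mass `r > 0` and a point of `A`, with addition
`(r, a) + (s, b) = (r + s, a +_{r/(r+s)} b)`. The axioms for `+_p` make the cone a commutative
monoid, so sums over the support of `d` are defined independently of any order, and `bary v` is
compatible with convex combinations (`bary_of_weights_eq`). The value of `t` in `A` under `v` is the
least upper bound of the barycentres of the elements of `denote t` (`isLUB_realize`); in particular
it is determined by `denote t`. For `A = T_{Σ,E} X` and `v x = [x]_E` the value of `t` is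
`[t]_E`.
-/

namespace ConvPresentation

/-! ### Convex semilattices -/

/-- A convex semilattice: a join semilattice with operations `mix p x y = x +_p y` for
`p ∈ (0,1)` that satisfy the laws of a barycentric algebra and distribute over joins. As in `CSAx`,
the derived weights of the associativity and commutativity laws are variables constrained by
equations. -/
class ConvexSemilattice (A : Type u) extends SemilatticeSup A where
  mix : OpenUnit → A → A → A
  mix_assoc (p q r s : OpenUnit) (hr : (r : ℝ) = p * q)
    (hs : (s : ℝ) = p * (1 - q) / (1 - p * q)) (x y z : A) :
    mix p (mix q x y) z = mix r x (mix s y z)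
  mix_comm (p q : OpenUnit) (hq : (q : ℝ) = 1 - p) (x y : A) : mix p x y = mix q y x
  mix_self (p : OpenUnit) (x : A) : mix p x x = x
  sup_mix (p : OpenUnit) (x y z : A) : mix p (x ⊔ y) z = mix p x z ⊔ mix p y z

namespace ConvexSemilattice

variable {A : Type u} [ConvexSemilattice A]

theorem mix_sup (p : OpenUnit) (x y z : A) : mix p x (y ⊔ z) = mix p x y ⊔ mix p x z := by
  have hq : 1 - (p : ℝ) ∈ Set.Ioo (0 : ℝ) 1 := ⟨by linarith [p.2.2], by linarith [p.2.1]⟩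
  have h := mix_comm (A := A) p ⟨1 - p, hq⟩ rfl
  rw [h, h, h, sup_mix]

theorem mix_mono (p : OpenUnit) {x x' y y' : A} (hx : x ≤ x') (hy : y ≤ y') :
    mix p x y ≤ mix p x' y' := by
  rw [← sup_eq_right] at hx hy
  rw [← hx, ← hy, sup_mix, mix_sup]
  exact le_sup_of_le_left le_sup_left

/-- The interpretation of the operation symbols in a convex semilattice. -/
instance instStructure : csSig.Structure A where
  funMap {_} f xs := match f with
    | CSOp.oplus => xs 0 ⊔ xs 1
    | CSOp.cplus p => mix p (xs 0) (xs 1)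
  RelMap r _ := nomatch r

end ConvexSemilattice

open ConvexSemilattice

section Terms

variable {X : Type u} {A : Type v} [ConvexSemilattice A]

theorem realize_tOplus (h : X → A) (s t : csSig.Term X) :
    (tOplus s t).realize h = s.realize h ⊔ t.realize h := rfl

theorem realize_tCplus (h : X → A) (p : OpenUnit) (s t : csSig.Term X) :
    (tCplus p s t).realize h = mix p (s.realize h) (t.realize h) := rfl

theorem tOplus_subst {Y : Type v} (s t : csSig.Term X) (σ : X → csSig.Term Y) :
    (tOplus s t).subst σ = tOplus (s.subst σ) (t.subst σ) := by
  simp only [tOplus, FirstOrder.Language.Term.subst]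
  congr 1
  funext i
  fin_cases i <;> rfl

theorem tCplus_subst {Y : Type v} (p : OpenUnit) (s t : csSig.Term X) (σ : X → csSig.Term Y) :
    (tCplus p s t).subst σ = tCplus p (s.subst σ) (t.subst σ) := by
  simp only [tCplus, FirstOrder.Language.Term.subst]
  congr 1
  funext i
  fin_cases i <;> rfl

/-- Structural induction on terms over the signature of convex semilattices. -/
theorem csTerm_induction {P : csSig.Term X → Prop}
    (var : ∀ x, P (FirstOrder.Language.Term.var x))
    (oplus : ∀ s t, P s → P t → P (tOplus s t))
    (cplus : ∀ p s t, P s → P t → P (tCplus p s t)) (t : csSig.Term X) : P t := by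
  induction t with
  | var x => exact var x
  | @func n f ts ih =>
    have eta : ∀ us : Fin 2 → csSig.Term X, us = ![us 0, us 1] := fun us => by
      funext i
      fin_cases i <;> rfl
    change CSOp n at f
    cases f with
    | oplus =>
      rw [eta ts]
      exact oplus _ _ (ih 0) (ih 1)
    | cplus p =>
      rw [eta ts]
      exact cplus p _ _ (ih 0) (ih 1)

/-- Soundness: provably equal terms have the same value in every convex semilattice. -/
theorem Eqv.realize_eq {s t : convexSemilattices.sig.Term X} (h : convexSemilattices.Eqv s t)
    (v : X → A) : FirstOrder.Language.Term.realize (L := csSig) v s =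
      FirstOrder.Language.Term.realize (L := csSig) v t := by
  induction h with
  | @ax l r h σ =>
    have key : ∀ v : ℕ → A, FirstOrder.Language.Term.realize (L := csSig) v l =
        FirstOrder.Language.Term.realize (L := csSig) v r := by
      intro v
      cases h with
      | assoc => exact sup_assoc _ _ _
      | comm => exact sup_comm _ _
      | idem => exact sup_idem _
      | assocP p q r s hr hs => exact mix_assoc p q r s hr hs _ _ _
      | commP p q hq => exact mix_comm p q hq _ _
      | idemP p => exact mix_self p _
      | distrib p => exact sup_mix p _ _ _
    exact (FirstOrder.Language.Term.realize_subst).trans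
      ((key _).trans (FirstOrder.Language.Term.realize_subst).symm)
  | refl t => rfl
  | symm _ ih => exact ih.symm
  | trans _ _ ih₁ ih₂ => exact ih₁.trans ih₂
  | congr f ts ts' _ ih =>
    exact congrArg (FirstOrder.Language.Structure.funMap (L := csSig) f) (funext ih)

/-- Maps that preserve both operations commute with the interpretation of terms. -/
theorem map_realize {B : Type w} [ConvexSemilattice B] (φ : A → B)
    (hsup : ∀ a b, φ (a ⊔ b) = φ a ⊔ φ b) (hmix : ∀ p a b, φ (mix p a b) = mix p (φ a) (φ b))
    (v : X → A) (t : csSig.Term X) : φ (t.realize v) = t.realize (fun x => φ (v x)) := by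
  induction t using csTerm_induction with
  | var x => rfl
  | oplus s t hs ht => rw [realize_tOplus, realize_tOplus, hsup, hs, ht]
  | cplus p s t hs ht => rw [realize_tCplus, realize_tCplus, hmix, hs, ht]

end Terms

/-! ### Classes of terms form a convex semilattice -/

section Cls

variable {X : Type u}

theorem Eqv.tOplus {s s' t t' : csSig.Term X} (hs : convexSemilattices.Eqv s s')
    (ht : convexSemilattices.Eqv t t') :
    convexSemilattices.Eqv (tOplus s t) (tOplus s' t') := by
  refine AlgTheory.Eqv.congr (E := convexSemilattices) _ _ _ fun i => ?_
  fin_cases i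
  · exact hs
  · exact ht

theorem Eqv.tCplus {s s' t t' : csSig.Term X} (p : OpenUnit) (hs : convexSemilattices.Eqv s s')
    (ht : convexSemilattices.Eqv t t') :
    convexSemilattices.Eqv (tCplus p s t) (tCplus p s' t') := by
  refine AlgTheory.Eqv.congr (E := convexSemilattices) _ _ _ fun i => ?_
  fin_cases i
  · exact hs
  · exact ht

/-- The convex union of classes of terms. -/
def clsOplus : convexSemilattices.Cls X → convexSemilattices.Cls X → convexSemilattices.Cls X :=
  Quotient.map₂ tOplus fun _ _ hs _ _ ht => Eqv.tOplus hs ht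

/-- The convex combination of classes of terms. -/
def clsCplus (p : OpenUnit) :
    convexSemilattices.Cls X → convexSemilattices.Cls X → convexSemilattices.Cls X :=
  Quotient.map₂ (tCplus p) fun _ _ hs _ _ ht => Eqv.tCplus p hs ht

/-- The substitution of three terms for the variables `x`, `y`, `z` of the axioms. -/
def substThree (a b c : csSig.Term X) : ℕ → csSig.Term X
  | 0 => a
  | 1 => b
  | _ => c

theorem vx_subst (a b c : csSig.Term X) : vx.subst (substThree a b c) = a := rfl

theorem vy_subst (a b c : csSig.Term X) : vy.subst (substThree a b c) = b := rfl

theorem vz_subst (a b c : csSig.Term X) : vz.subst (substThree a b c) = c := rfl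

/-- The instance of an axiom at three given terms. -/
theorem CSAx.eqv_subst {l r : csSig.Term ℕ} (h : CSAx (l, r)) (a b c : csSig.Term X) :
    convexSemilattices.Eqv (l.subst (substThree a b c)) (r.subst (substThree a b c)) :=
  AlgTheory.Eqv.ax (E := convexSemilattices) h _

theorem cls_ind {P : convexSemilattices.Cls X → Prop}
    (h : ∀ t : csSig.Term X, P (convexSemilattices.cls t)) (c : convexSemilattices.Cls X) : P c := by
  obtain ⟨t, rfl⟩ := convexSemilattices.exists_rep c
  exact h t

noncomputable instance instConvexSemilatticeCls :
    ConvexSemilattice (convexSemilattices.Cls X) where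
  toSemilatticeSup := @SemilatticeSup.mk' _ ⟨clsOplus⟩
    (by
      intro x y
      induction x using cls_ind with | h a => ?_
      induction y using cls_ind with | h b => ?_
      refine convexSemilattices.cls_eq.2 ?_
      simpa only [tOplus_subst, vx_subst, vy_subst] using CSAx.comm.eqv_subst a b b)
    (by
      intro x y z
      induction x using cls_ind with | h a => ?_
      induction y using cls_ind with | h b => ?_
      induction z using cls_ind with | h c => ?_
      refine convexSemilattices.cls_eq.2 ?_
      simpa only [tOplus_subst, vx_subst, vy_subst, vz_subst] using CSAx.assoc.eqv_subst a b c)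
    (by
      intro x
      induction x using cls_ind with | h a => ?_
      refine convexSemilattices.cls_eq.2 ?_
      simpa only [tOplus_subst, vx_subst] using CSAx.idem.eqv_subst a a a)
  mix := clsCplus
  mix_assoc p q r s hr hs x y z := by
    induction x using cls_ind with | h a => ?_
    induction y using cls_ind with | h b => ?_
    induction z using cls_ind with | h c => ?_
    refine convexSemilattices.cls_eq.2 ?_
    simpa only [tCplus_subst, vx_subst, vy_subst, vz_subst] using
      (CSAx.assocP p q r s hr hs).eqv_subst a b c
  mix_comm p q hq x y := by
    induction x using cls_ind with | h a => ?_
    induction y using cls_ind with | h b => ?_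
    refine convexSemilattices.cls_eq.2 ?_
    simpa only [tCplus_subst, vx_subst, vy_subst] using (CSAx.commP p q hq).eqv_subst a b b
  mix_self p x := by
    induction x using cls_ind with | h a => ?_
    refine convexSemilattices.cls_eq.2 ?_
    simpa only [tCplus_subst, vx_subst] using (CSAx.idemP p).eqv_subst a a a
  sup_mix p x y z := by
    induction x using cls_ind with | h a => ?_
    induction y using cls_ind with | h b => ?_
    induction z using cls_ind with | h c => ?_
    refine convexSemilattices.cls_eq.2 ?_
    simpa only [tOplus_subst, tCplus_subst, vx_subst, vy_subst, vz_subst] using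
      (CSAx.distrib p).eqv_subst a b c

theorem realize_cls_var (t : csSig.Term X) :
    t.realize (fun x => convexSemilattices.cls (FirstOrder.Language.Term.var x)) =
      convexSemilattices.cls t := by
  induction t using csTerm_induction with
  | var x => rfl
  | oplus s t hs ht => rw [realize_tOplus, hs, ht]; rfl
  | cplus p s t hs ht => rw [realize_tCplus, hs, ht]; rfl

end Cls

/-! ### Convex sets of distributions form a convex semilattice -/

theorem wt_union {X : Type u} (S T : Set (FDist X)) : wt (S ∪ T) = wt S ∪ wt T :=
  Set.image_union _ _ _

theorem wt_convUnion {X : Type u} (S T : Set (FDist X)) :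
    wt (convUnion S T) = convexHull ℝ (wt S ∪ wt T) := by
  rw [convUnion, wt_conv, wt_union]

/-- The convex combination `p d + (1 - p) e` of two distributions. -/
noncomputable def FDist.mix {X : Type u} (p : OpenUnit) (d e : FDist X) : FDist X :=
  ((convex_simplex X) ⟨d, trivial, rfl⟩ ⟨e, trivial, rfl⟩ p.2.1.le (sub_nonneg.2 p.2.2.le)
    (add_sub_cancel (p : ℝ) 1)).choose

theorem FDist.mix_weights {X : Type u} (p : OpenUnit) (d e : FDist X) :
    (FDist.mix p d e).weights = (p : ℝ) • d.weights + (1 - (p : ℝ)) • e.weights :=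
  ((convex_simplex X) ⟨d, trivial, rfl⟩ ⟨e, trivial, rfl⟩ p.2.1.le (sub_nonneg.2 p.2.2.le)
    (add_sub_cancel (p : ℝ) 1)).choose_spec.2

theorem minkowskiSum_eq_image2 {X : Type u} (p : OpenUnit) (S T : Set (FDist X)) :
    minkowskiSum p S T = Set.image2 (FDist.mix p) S T := by
  ext d
  refine exists_congr fun d₁ => and_congr_right fun _ => exists_congr fun d₂ =>
    and_congr_right fun _ => ?_
  rw [← FDist.mix_weights, Convexity.StdSimplex.weights_inj, eq_comm]

theorem wt_minkowskiSum {X : Type u} (p : OpenUnit) (S T : Set (FDist X)) :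
    wt (minkowskiSum p S T) = (p : ℝ) • wt S + (1 - (p : ℝ)) • wt T := by
  rw [minkowskiSum_eq_image2, wt, Set.image_image2]
  simp only [FDist.mix_weights]
  rw [wt, wt, ← Set.image_smul, ← Set.image_smul, ← Set.image2_add, Set.image2_image_left,
    Set.image2_image_right, Set.image2_image_left, Set.image2_image_right]

namespace ConvSet

variable {X : Type u}

/-- The convex union of two elements of `C X`. -/
def oplus (S T : ConvSet X) : ConvSet X where
  carrier := convUnion S.carrier T.carrier
  nonempty := by
    rw [← Set.image_nonempty, ← wt, wt_convUnion, convexHull_nonempty_iff]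
    exact S.wt_nonempty.inl
  fg := by
    obtain ⟨F, hF, hS⟩ := S.fg
    obtain ⟨G, hG, hT⟩ := T.fg
    refine ⟨F ∪ G, hF.union hG, wt_injective ?_⟩
    rw [wt_convUnion, hS, hT, wt_conv, wt_conv, wt_conv, wt_union,
      convexHull_convexHull_union_left, convexHull_convexHull_union_right]

/-- The Minkowski combination of two elements of `C X`. -/
def cplus (p : OpenUnit) (S T : ConvSet X) : ConvSet X where
  carrier := minkowskiSum p S.carrier T.carrier
  nonempty := by
    rw [minkowskiSum_eq_image2]
    exact S.nonempty.image2 T.nonempty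
  fg := by
    obtain ⟨F, hF, hS⟩ := S.fg
    obtain ⟨G, hG, hT⟩ := T.fg
    refine ⟨minkowskiSum p F G, ?_, wt_injective ?_⟩
    · rw [minkowskiSum_eq_image2]
      exact hF.image2 _ hG
    · rw [wt_minkowskiSum, hS, hT, wt_conv, wt_conv, wt_conv, wt_minkowskiSum, convexHull_add,
        convexHull_smul, convexHull_smul]

theorem wt_oplus (S T : ConvSet X) :
    wt (oplus S T).carrier = convexHull ℝ (wt S.carrier ∪ wt T.carrier) := wt_convUnion _ _

theorem wt_cplus (p : OpenUnit) (S T : ConvSet X) :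
    wt (cplus p S T).carrier = (p : ℝ) • wt S.carrier + (1 - (p : ℝ)) • wt T.carrier :=
  wt_minkowskiSum _ _ _

noncomputable instance instConvexSemilattice : ConvexSemilattice (ConvSet X) where
  toSemilatticeSup := @SemilatticeSup.mk' _ ⟨oplus⟩
    (fun S T => ext_wt <| by
      change wt (oplus S T).carrier = wt (oplus T S).carrier
      rw [wt_oplus, wt_oplus, Set.union_comm])
    (fun S T U => ext_wt <| by
      change wt (oplus (oplus S T) U).carrier = wt (oplus S (oplus T U)).carrier
      simp only [wt_oplus]
      rw [convexHull_convexHull_union_left, convexHull_convexHull_union_right, Set.union_assoc])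
    (fun S => ext_wt <| by
      change wt (oplus S S).carrier = wt S.carrier
      rw [wt_oplus, Set.union_self, S.convex_wt.convexHull_eq])
  mix := cplus
  mix_assoc p q r s hr hs S T U := ext_wt <| by
    have hpq : (1 : ℝ) - p * q ≠ 0 := by
      rw [← hr]
      exact (sub_pos.2 r.2.2).ne'
    have h₁ : (1 - (r : ℝ)) * s = p * (1 - q) := by
      rw [hr, hs]
      field_simp
    have h₂ : (1 - (r : ℝ)) * (1 - s) = 1 - p := by
      rw [mul_sub, h₁, hr]
      ring
    simp only [wt_cplus, smul_add, smul_smul]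
    rw [h₁, h₂, hr, add_assoc]
  mix_comm p q hq S T := ext_wt <| by
    rw [wt_cplus, wt_cplus, hq, sub_sub_cancel, add_comm]
  mix_self p S := ext_wt <| by
    rw [wt_cplus, ← S.convex_wt.add_smul p.2.1.le (sub_nonneg.2 p.2.2.le), add_sub_cancel, one_smul]
  sup_mix p S T U := ext_wt <| by
    change wt (cplus p (oplus S T) U).carrier = wt (oplus (cplus p S U) (cplus p T U)).carrier
    simp only [wt_cplus, wt_oplus]
    rw [← Set.union_add, ← Set.smul_set_union, convexHull_add, convexHull_smul, convexHull_smul,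
      U.convex_wt.convexHull_eq]

theorem wt_sup (S T : ConvSet X) :
    wt (S ⊔ T).carrier = convexHull ℝ (wt S.carrier ∪ wt T.carrier) := wt_oplus S T

theorem wt_mix (p : OpenUnit) (S T : ConvSet X) :
    wt (mix p S T).carrier = (p : ℝ) • wt S.carrier + (1 - (p : ℝ)) • wt T.carrier :=
  wt_cplus p S T

theorem map_sup {Y : Type v} (f : X → Y) (S T : ConvSet X) :
    (S ⊔ T).map f = S.map f ⊔ T.map f := ext_wt <| by
  rw [wt_map, wt_sup, wt_sup, wt_map, wt_map, LinearMap.image_convexHull, Set.image_union]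

theorem map_mix {Y : Type v} (f : X → Y) (p : OpenUnit) (S T : ConvSet X) :
    (mix p S T).map f = mix p (S.map f) (T.map f) := ext_wt <| by
  rw [wt_map, wt_mix, wt_mix, wt_map, wt_map, Set.image_add, image_smul_set, image_smul_set]

/-- The weights of a convex union are the segments between the two sets. -/
theorem mem_wt_sup {S T : ConvSet X} {v : X →₀ ℝ} :
    v ∈ wt (S ⊔ T).carrier ↔ ∃ x ∈ wt S.carrier, ∃ y ∈ wt T.carrier, v ∈ segment ℝ x y := by
  rw [wt_sup, S.convex_wt.convexHull_union T.convex_wt S.wt_nonempty T.wt_nonempty, mem_convexJoin]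

/-- The multiplication of `C` preserves convex unions, because Minkowski combinations are additive
in the weights. -/
theorem join_sup (S T : ConvSet (ConvSet X)) : (S ⊔ T).join = S.join ⊔ T.join := ext_wt <| by
  ext v
  rw [mem_wt_sup, wt_join, wt_join, wt_join]
  simp only [Set.mem_iUnion, exists_prop, mem_wt_sup]
  constructor
  · rintro ⟨_, ⟨Φ, hΦ, Ψ, hΨ, a, b, ha, hb, hab, rfl⟩, hv⟩
    rw [mink_comb (nonneg_of_mem_wt hΦ) (nonneg_of_mem_wt hΨ) ha hb] at hv
    obtain ⟨_, ⟨x, hx, rfl⟩, _, ⟨y, hy, rfl⟩, rfl⟩ := hv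
    exact ⟨x, ⟨Φ, hΦ, hx⟩, y, ⟨Ψ, hΨ, hy⟩, a, b, ha, hb, hab, rfl⟩
  · rintro ⟨x, ⟨Φ, hΦ, hx⟩, y, ⟨Ψ, hΨ, hy⟩, a, b, ha, hb, hab, rfl⟩
    refine ⟨_, ⟨Φ, hΦ, Ψ, hΨ, a, b, ha, hb, hab, rfl⟩, ?_⟩
    rw [mink_comb (nonneg_of_mem_wt hΦ) (nonneg_of_mem_wt hΨ) ha hb]
    exact Set.add_mem_add (Set.smul_mem_smul_set hx) (Set.smul_mem_smul_set hy)

theorem join_mix (p : OpenUnit) (S T : ConvSet (ConvSet X)) :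
    (mix p S T).join = mix p S.join T.join := ext_wt <| by
  have hp := sub_nonneg.2 p.2.2.le
  ext v
  rw [wt_mix, wt_join, wt_join, wt_join, wt_mix]
  simp only [Set.mem_iUnion, exists_prop]
  constructor
  · rintro ⟨_, ⟨_, ⟨Φ, hΦ, rfl⟩, _, ⟨Ψ, hΨ, rfl⟩, rfl⟩, hv⟩
    rw [mink_comb (nonneg_of_mem_wt hΦ) (nonneg_of_mem_wt hΨ) p.2.1.le hp] at hv
    obtain ⟨_, ⟨x, hx, rfl⟩, _, ⟨y, hy, rfl⟩, rfl⟩ := hv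
    exact Set.add_mem_add (Set.smul_mem_smul_set (Set.mem_biUnion hΦ hx))
      (Set.smul_mem_smul_set (Set.mem_biUnion hΨ hy))
  · rintro ⟨_, ⟨x, hx, rfl⟩, _, ⟨y, hy, rfl⟩, rfl⟩
    simp only [Set.mem_iUnion, exists_prop] at hx hy
    obtain ⟨Φ, hΦ, hx⟩ := hx
    obtain ⟨Ψ, hΨ, hy⟩ := hy
    refine ⟨_, Set.add_mem_add (Set.smul_mem_smul_set hΦ) (Set.smul_mem_smul_set hΨ), ?_⟩
    rw [mink_comb (nonneg_of_mem_wt hΦ) (nonneg_of_mem_wt hΨ) p.2.1.le hp]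
    exact Set.add_mem_add (Set.smul_mem_smul_set hx) (Set.smul_mem_smul_set hy)

end ConvSet

/-! ### Barycentres in a convex semilattice -/

/-- A point of `A` with a positive mass. Rays are added by adding the masses and taking the
weighted mean of the points, so that they form an open cone with base `A`. -/
@[ext]
structure Ray (A : Type u) where
  mass : ℝ
  mass_pos : 0 < mass
  point : A

/-- The cone over `A`: the rays together with an apex `0`. -/
abbrev Cone (A : Type u) : Type u := WithZero (Ray A)

namespace Cone

variable {A : Type u}

/-- The point `a` with mass `r`; junk value `0` for negative `r`. -/
noncomputable def ray (a : A) (r : ℝ) : Cone A :=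
  open Classical in if h : 0 < r then ((⟨r, h, a⟩ : Ray A) : Cone A) else 0

theorem ray_of_pos (a : A) {r : ℝ} (h : 0 < r) : ray a r = ((⟨r, h, a⟩ : Ray A) : Cone A) :=
  dif_pos h

theorem ray_zero (a : A) : ray a 0 = 0 := dif_neg (lt_irrefl _)

theorem ray_injective {a b : A} (h : ray a 1 = ray b 1) : a = b := by
  rw [ray_of_pos _ one_pos, ray_of_pos _ one_pos] at h
  exact congrArg Ray.point (WithZero.coe_injective h)

end Cone

/-- The weight `r / (r + s)`. -/
noncomputable def ratio (r s : ℝ) (hr : 0 < r) (hs : 0 < s) : OpenUnit :=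
  ⟨r / (r + s), by positivity, (div_lt_one (by positivity)).2 (by linarith)⟩

section Barycentre

variable {X : Type v} {A : Type u} [ConvexSemilattice A]

namespace Ray

noncomputable instance instAdd : Add (Ray A) where
  add a b := ⟨a.mass + b.mass, add_pos a.mass_pos b.mass_pos,
    mix (ratio a.mass b.mass a.mass_pos b.mass_pos) a.point b.point⟩

theorem mass_add (a b : Ray A) : (a + b).mass = a.mass + b.mass := rfl

theorem point_add (a b : Ray A) : (a + b).point =
    mix (ratio a.mass b.mass a.mass_pos b.mass_pos) a.point b.point := rfl

/-- For normalised weights, the law `assocP` is associativity of the addition of rays. -/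
noncomputable instance instAddCommSemigroup : AddCommSemigroup (Ray A) where
  add_assoc a b c := by
    have ha := a.mass_pos
    have hb := b.mass_pos
    have hc := c.mass_pos
    refine Ray.ext (add_assoc _ _ _) ?_
    simp only [point_add]
    refine mix_assoc _ _ _ _ ?_ ?_ _ _ _
    · simp only [ratio, mass_add]
      field_simp
      ring
    · simp only [ratio, mass_add]
      have h : 1 - (a.mass + b.mass) / (a.mass + b.mass + c.mass) * (a.mass / (a.mass + b.mass)) =
          (b.mass + c.mass) / (a.mass + b.mass + c.mass) := by
        field_simp
        ring
      rw [h]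
      field_simp
      ring
  add_comm a b := by
    have ha := a.mass_pos
    have hb := b.mass_pos
    refine Ray.ext (add_comm _ _) (mix_comm _ _ ?_ _ _)
    simp only [ratio]
    field_simp
    ring

end Ray

namespace Cone

theorem ray_add (a : A) {r s : ℝ} (hr : 0 ≤ r) (hs : 0 ≤ s) :
    ray a (r + s) = ray a r + ray a s := by
  rcases hr.eq_or_lt with rfl | hr
  · rw [zero_add, ray_zero, zero_add]
  rcases hs.eq_or_lt with rfl | hs
  · rw [add_zero, ray_zero, add_zero]
  rw [ray_of_pos a hr, ray_of_pos a hs, ray_of_pos a (add_pos hr hs), ← WithZero.coe_add]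
  exact congrArg _ (Ray.ext rfl (mix_self _ a).symm)

/-- The sum of two points with masses `p` and `1 - p` is their mixture with mass `1`. -/
theorem ray_add_ray_of_pos (p : OpenUnit) (a b : A) :
    ray a p + ray b (1 - (p : ℝ)) = ray (mix p a b) 1 := by
  have hq : 0 < 1 - (p : ℝ) := sub_pos.2 p.2.2
  rw [ray_of_pos a p.2.1, ray_of_pos b hq, ray_of_pos _ one_pos, ← WithZero.coe_add]
  refine congrArg _ (Ray.ext (add_sub_cancel (p : ℝ) 1) ?_)
  rw [Ray.point_add]
  congr 1
  exact Subtype.ext (by simp [ratio])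

/-- Multiplication of the masses by a positive constant. -/
noncomputable def scale (c : ℝ) (hc : 0 < c) : Cone A →+ Cone A :=
  WithZero.mapAddHom
    { toFun := fun a => ⟨c * a.mass, mul_pos hc a.mass_pos, a.point⟩
      map_add' := fun a b => by
        refine Ray.ext (mul_add _ _ _) ?_
        simp only [Ray.point_add]
        congr 1
        refine Subtype.ext ?_
        have ha := a.mass_pos
        have hb := b.mass_pos
        simp only [ratio]
        field_simp }

theorem scale_ray (c : ℝ) (hc : 0 < c) (a : A) {r : ℝ} (hr : 0 ≤ r) :
    scale c hc (ray a r) = ray a (c * r) := by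
  rcases hr.eq_or_lt with rfl | hr
  · rw [mul_zero, ray_zero, map_zero]
  · rw [ray_of_pos a hr, ray_of_pos a (mul_pos hc hr)]
    rfl

/-- The total mass of an element of the cone. -/
noncomputable def mass : Cone A →+ ℝ :=
  WithZero.lift { toFun := Ray.mass, map_add' := Ray.mass_add }

theorem mass_ray (a : A) {r : ℝ} (hr : 0 ≤ r) : mass (ray a r) = r := by
  rcases hr.eq_or_lt with rfl | hr
  · rw [ray_zero, map_zero]
  · rw [ray_of_pos a hr]
    rfl

theorem exists_eq_ray {z : Cone A} (h : mass z = 1) : ∃ a, z = ray a 1 := by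
  induction z using WithZero.recZeroCoe with
  | zero => exact absurd h (by rw [map_zero]; exact zero_ne_one)
  | coe z =>
    refine ⟨z.point, ?_⟩
    rw [ray_of_pos _ one_pos]
    exact congrArg _ (Ray.ext h rfl)

/-- The sum in the cone over `A` of the points `v x` with masses `α x`. -/
noncomputable def sum (v : X → A) (α : X →₀ ℝ) : Cone A := α.sum fun x r => ray (v x) r

theorem sum_eq (v : X → A) (α : X →₀ ℝ) {T : Finset X} (h : α.support ⊆ T) :
    sum v α = ∑ x ∈ T, ray (v x) (α x) :=
  Finsupp.sum_of_support_subset _ h _ fun _ _ => ray_zero _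

theorem sum_add (v : X → A) {α β : X →₀ ℝ} (hα : 0 ≤ α) (hβ : 0 ≤ β) :
    sum v (α + β) = sum v α + sum v β := by
  classical
  rw [sum_eq v _ Finsupp.support_add, sum_eq v α Finset.subset_union_left,
    sum_eq v β Finset.subset_union_right, ← Finset.sum_add_distrib]
  exact Finset.sum_congr rfl fun x _ => ray_add _ (hα x) (hβ x)

theorem sum_smul (v : X → A) {c : ℝ} (hc : 0 < c) {α : X →₀ ℝ} (hα : 0 ≤ α) :
    sum v (c • α) = scale c hc (sum v α) := by
  rw [sum_eq v _ Finsupp.support_smul, sum_eq v α Finset.Subset.rfl, map_sum]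
  exact Finset.sum_congr rfl fun x _ => (scale_ray c hc _ (hα x)).symm

theorem mass_sum (v : X → A) {α : X →₀ ℝ} (hα : 0 ≤ α) :
    mass (sum v α) = α.sum fun _ r => r := by
  rw [sum, Finsupp.sum, map_sum]
  exact Finset.sum_congr rfl fun x _ => mass_ray _ (hα x)

theorem exists_sum_eq_ray (v : X → A) (d : FDist X) : ∃ a, sum v d.weights = ray a 1 :=
  exists_eq_ray ((mass_sum v d.nonneg).trans d.total)

end Cone

/-- The barycentre of a distribution `d` on `X` under `v : X → A`: the point of the sum, in the
cone over `A`, of the points `v x` with masses `d x`. -/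
noncomputable def bary (v : X → A) (d : FDist X) : A := (Cone.exists_sum_eq_ray v d).choose

theorem sum_weights (v : X → A) (d : FDist X) : Cone.sum v d.weights = Cone.ray (bary v d) 1 :=
  (Cone.exists_sum_eq_ray v d).choose_spec

theorem bary_single (v : X → A) (x : X) : bary v (Convexity.StdSimplex.single x) = v x := by
  refine Cone.ray_injective ?_
  rw [← sum_weights, Convexity.StdSimplex.weights_single, Cone.sum,
    Finsupp.sum_single_index (Cone.ray_zero _)]

theorem bary_of_weights_eq (v : X → A) (p : OpenUnit) {d d₁ d₂ : FDist X}
    (h : d.weights = (p : ℝ) • d₁.weights + (1 - (p : ℝ)) • d₂.weights) :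
    bary v d = mix p (bary v d₁) (bary v d₂) := by
  have hq : 0 < 1 - (p : ℝ) := sub_pos.2 p.2.2
  refine Cone.ray_injective ?_
  rw [← sum_weights, h, Cone.sum_add v (smul_nonneg p.2.1.le d₁.nonneg)
    (smul_nonneg hq.le d₂.nonneg), Cone.sum_smul v p.2.1 d₁.nonneg, Cone.sum_smul v hq d₂.nonneg,
    sum_weights, sum_weights, Cone.scale_ray _ _ _ zero_le_one, Cone.scale_ray _ _ _ zero_le_one,
    mul_one, mul_one, Cone.ray_add_ray_of_pos]

end Barycentre

/-! ### The value of a term is a supremum of barycentres -/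

/-- The convex set of distributions denoted by a term. -/
noncomputable def denote {X : Type u} (t : csSig.Term X) : ConvSet X := t.realize ConvSet.pure

section Lub

variable {X : Type v} {A : Type u} [ConvexSemilattice A]

theorem mem_denote_oplus {s t : csSig.Term X} {d : FDist X} :
    d ∈ (denote (tOplus s t)).carrier ↔ ∃ d₁ ∈ (denote s).carrier, ∃ d₂ ∈ (denote t).carrier,
      d.weights ∈ segment ℝ d₁.weights d₂.weights := by
  rw [← mem_wt, denote, realize_tOplus, ConvSet.mem_wt_sup]
  simp only [wt, Set.exists_mem_image]
  rfl

theorem mem_denote_cplus {p : OpenUnit} {s t : csSig.Term X} {d : FDist X} :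
    d ∈ (denote (tCplus p s t)).carrier ↔ ∃ d₁ ∈ (denote s).carrier, ∃ d₂ ∈ (denote t).carrier,
      d.weights = (p : ℝ) • d₁.weights + (1 - (p : ℝ)) • d₂.weights := Iff.rfl

/-- The barycentres of the distributions in `denote t` lie below the value of `t`: mixtures are
monotone, and `c = c +_p c` bounds the mixtures that a convex union adds. -/
theorem bary_le_realize (v : X → A) (t : csSig.Term X) {d : FDist X}
    (hd : d ∈ (denote t).carrier) : bary v d ≤ t.realize v := by
  induction t using csTerm_induction generalizing d with
  | var x =>
    obtain rfl : d = Convexity.StdSimplex.single x := hd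
    exact (bary_single v x).le
  | oplus s t hs ht =>
    obtain ⟨d₁, h₁, d₂, h₂, a, b, ha, hb, hab, h⟩ := mem_denote_oplus.1 hd
    rw [realize_tOplus]
    have h₁ := (hs h₁).trans (le_sup_left (b := t.realize v))
    have h₂ := (ht h₂).trans (le_sup_right (a := s.realize v))
    rcases ha.eq_or_lt with rfl | ha
    · obtain rfl : b = 1 := by linarith
      obtain rfl : d₂ = d := Convexity.StdSimplex.weights_inj.1 (by simpa using h)
      exact h₂
    rcases hb.eq_or_lt with rfl | hb
    · obtain rfl : a = 1 := by linarith
      obtain rfl : d₁ = d := Convexity.StdSimplex.weights_inj.1 (by simpa using h)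
      exact h₁
    -- The endpoints of the segment are done; what is left has a weight in `(0,1)`.
    obtain rfl : b = 1 - a := by linarith
    rw [bary_of_weights_eq v ⟨a, ha, by linarith⟩ h.symm]
    exact (mix_mono _ h₁ h₂).trans (mix_self _ _).le
  | cplus p s t hs ht =>
    obtain ⟨d₁, h₁, d₂, h₂, h⟩ := mem_denote_cplus.1 hd
    rw [bary_of_weights_eq v p h]
    exact mix_mono p (hs h₁) (ht h₂)

/-- An upper bound for the barycentres is an upper bound for the value of the term, even under an
arbitrary join-preserving map `φ`. The generality in `φ` makes the induction pass through
`s +_p t`: by distributivity, `fun a => φ (a +_p t)` is join-preserving again. -/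
theorem map_realize_le (v : X → A) (t : csSig.Term X) (φ : A → A)
    (hφ : ∀ a b, φ (a ⊔ b) = φ a ⊔ φ b) {c : A}
    (hc : ∀ d ∈ (denote t).carrier, φ (bary v d) ≤ c) : φ (t.realize v) ≤ c := by
  induction t using csTerm_induction generalizing φ with
  | var x =>
    have h := hc (Convexity.StdSimplex.single x) rfl
    rwa [bary_single] at h
  | oplus s t hs ht =>
    obtain ⟨e₁, he₁⟩ := (denote s).nonempty
    obtain ⟨e₂, he₂⟩ := (denote t).nonempty
    rw [realize_tOplus, hφ]
    exact sup_le
      (hs φ hφ fun d hd => hc d (mem_denote_oplus.2 ⟨d, hd, e₂, he₂, left_mem_segment ℝ _ _⟩))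
      (ht φ hφ fun d hd => hc d (mem_denote_oplus.2 ⟨e₁, he₁, d, hd, right_mem_segment ℝ _ _⟩))
  | cplus p s t hs ht =>
    rw [realize_tCplus]
    refine hs (fun a => φ (mix p a (t.realize v))) (fun a b => by rw [sup_mix, hφ]) fun d₁ h₁ => ?_
    refine ht (fun b => φ (mix p (bary v d₁) b)) (fun a b => by rw [mix_sup, hφ]) fun d₂ h₂ => ?_
    rw [← bary_of_weights_eq v p (FDist.mix_weights p d₁ d₂)]
    exact hc _ (mem_denote_cplus.2 ⟨d₁, h₁, d₂, h₂, FDist.mix_weights p d₁ d₂⟩)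

theorem isLUB_realize (v : X → A) (t : csSig.Term X) :
    IsLUB (bary v '' (denote t).carrier) (t.realize v) := by
  refine ⟨?_, fun c hc => ?_⟩
  · rintro _ ⟨d, hd, rfl⟩
    exact bary_le_realize v t hd
  · exact map_realize_le v t id (fun _ _ => rfl) fun d hd => hc ⟨d, hd, rfl⟩

end Lub

/-- Completeness: terms that denote the same convex set are provably equal. -/
theorem eqv_of_denote_eq {X : Type u} {s t : csSig.Term X} (h : denote s = denote t) :
    convexSemilattices.Eqv s t := by
  have key := isLUB_realize
    (fun x : X => convexSemilattices.cls (FirstOrder.Language.Term.var x)) s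
  rw [h] at key
  have := key.unique (isLUB_realize _ t)
  rw [realize_cls_var, realize_cls_var] at this
  exact convexSemilattices.cls_eq.1 this

/-! ### Every finitely generated convex set is denoted by a term -/

section Surjective

variable {X : Type u}

theorem exists_wt_denote_eq_singleton (d : FDist X) :
    ∃ t : csSig.Term X, wt (denote t).carrier = {d.weights} := by
  have hconv : Convex ℝ {v : X →₀ ℝ | ∃ t : csSig.Term X, wt (denote t).carrier = {v}} := by
    rintro v ⟨s, hs⟩ w ⟨t, ht⟩ a b ha hb hab
    rcases ha.eq_or_lt with rfl | ha
    · obtain rfl : b = 1 := by linarith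
      exact ⟨t, by simpa using ht⟩
    rcases hb.eq_or_lt with rfl | hb
    · obtain rfl : a = 1 := by linarith
      exact ⟨s, by simpa using hs⟩
    obtain rfl : b = 1 - a := by linarith
    refine ⟨tCplus ⟨a, ha, by linarith⟩ s t, ?_⟩
    rw [denote, realize_tCplus, ConvSet.wt_mix]
    change _ • wt (denote s).carrier + _ • wt (denote t).carrier = _
    rw [hs, ht, Set.smul_set_singleton, Set.smul_set_singleton, Set.singleton_add_singleton]
  have h := hconv.sum_mem (t := d.weights.support) (w := d.weights)
    (z := fun x => Finsupp.single x (1 : ℝ)) (fun x _ => d.nonneg x) d.total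
    fun x _ => ⟨FirstOrder.Language.Term.var x, ConvSet.wt_pure x⟩
  have e : ∑ x ∈ d.weights.support, d.weights x • Finsupp.single x (1 : ℝ) = d.weights := by
    simp only [Finsupp.smul_single, smul_eq_mul, mul_one]
    exact Finsupp.sum_single d.weights
  rwa [e] at h

theorem denote_surjective : Function.Surjective (denote (X := X)) := by
  intro S
  obtain ⟨F, hF, hS⟩ := S.fg
  have key : F.Nonempty → ∃ t : csSig.Term X, wt (denote t).carrier = convexHull ℝ (wt F) := by
    clear hS
    induction F, hF using Set.Finite.induction_on with
    | empty => exact fun h => absurd h Set.not_nonempty_empty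
    | @insert d F _ _ ih =>
      intro _
      obtain ⟨s, hs⟩ := exists_wt_denote_eq_singleton d
      rcases F.eq_empty_or_nonempty with rfl | hne
      · exact ⟨s, by rw [hs]; simp [wt]⟩
      · obtain ⟨t, ht⟩ := ih hne
        refine ⟨tOplus s t, ?_⟩
        rw [denote, realize_tOplus, ConvSet.wt_sup]
        change convexHull ℝ (wt (denote s).carrier ∪ wt (denote t).carrier) = _
        rw [hs, ht, convexHull_convexHull_union_right, Set.insert_eq, wt_union]
        simp [wt]
  have hne : F.Nonempty := by
    have := S.wt_nonempty
    rw [hS, wt_conv, convexHull_nonempty_iff] at this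
    exact Set.image_nonempty.1 this
  obtain ⟨t, ht⟩ := key hne
  exact ⟨t, ConvSet.ext_wt (by rw [ht, hS, wt_conv])⟩

end Surjective

/-! ### The isomorphism of monads -/

/-- The denotation of classes of terms. -/
noncomputable def clsDenote {X : Type u} : convexSemilattices.Cls X → ConvSet X :=
  Quotient.lift denote fun _ _ h => Eqv.realize_eq h ConvSet.pure

theorem clsDenote_bijective {X : Type u} : Function.Bijective (clsDenote (X := X)) := by
  refine ⟨fun c c' h => ?_, fun S => ?_⟩
  · induction c using cls_ind with | h s => ?_
    induction c' using cls_ind with | h t => ?_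
    exact convexSemilattices.cls_eq.2 (eqv_of_denote_eq h)
  · obtain ⟨t, rfl⟩ := denote_surjective S
    exact ⟨convexSemilattices.cls t, rfl⟩

theorem denote_subst {X Y : Type u} (t : csSig.Term X) (σ : X → csSig.Term Y) :
    denote (t.subst σ) = t.realize (fun x => denote (σ x)) :=
  FirstOrder.Language.Term.realize_subst

theorem map_denote {X Y : Type u} (f : X → Y) (t : csSig.Term X) :
    (denote t).map f = t.realize (fun x => ConvSet.pure (f x)) := by
  rw [denote, map_realize (ConvSet.map f) (ConvSet.map_sup f) (ConvSet.map_mix f)]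
  simp only [ConvSet.map_pure]

theorem clsDenote_map {X Y : Type u} (f : X → Y) (c : convexSemilattices.Cls X) :
    clsDenote (AlgTheory.Cls.map convexSemilattices f c) = (clsDenote c).map f := by
  induction c using cls_ind with | h t => ?_
  exact (denote_subst t _).trans (map_denote f t).symm

/-- Substitution of terms for variables denotes the multiplication of `C`. -/
theorem denote_subst_id {X : Type u} (t : csSig.Term (csSig.Term X)) :
    denote (t.subst id) =
      ((denote (t.subst fun s =>
        FirstOrder.Language.Term.var (convexSemilattices.cls s))).map clsDenote).join := by
  rw [map_denote, map_realize ConvSet.join ConvSet.join_sup ConvSet.join_mix, denote_subst]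
  simp only [ConvSet.join_pure]
  exact (FirstOrder.Language.Term.realize_subst (L := csSig) (t := t)
    (tf := fun s => FirstOrder.Language.Term.var (convexSemilattices.cls s)) (v := clsDenote)).symm

theorem clsDenote_join {X : Type u} (c : convexSemilattices.Cls (convexSemilattices.Cls X)) :
    clsDenote (AlgTheory.Cls.join convexSemilattices c) =
      (clsDenote (AlgTheory.Cls.map convexSemilattices clsDenote c)).join := by
  obtain ⟨t, rfl⟩ := convexSemilattices.exists_rep₂ c
  rw [clsDenote_map]
  exact (congrArg clsDenote (AlgTheory.Cls.join_cls_subst convexSemilattices t id)).trans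
    (denote_subst_id t)

/-- The denotation as a map of monads from `T_{Σ,E}` to `C`. -/
noncomputable def denoteHom : convexSemilattices.termMonad ⟶ convMonad.{u} :=
  MonadHom.mk (T₁ := convexSemilattices.termMonad) (T₂ := convMonad.{u})
    { app := fun _ => TypeCat.ofHom clsDenote
      naturality := fun _ _ f => ConcreteCategory.hom_ext _ _ (clsDenote_map f) }
    (fun _ => rfl)
    (fun _ => ConcreteCategory.hom_ext (C := Type u) _ _ clsDenote_join)

theorem isInduced_denoteHom : IsInduced denoteHom.{u} where
  var _ _ := rfl
  oplus _ _ _ := rfl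
  cplus _ _ _ _ := rfl

theorem IsInduced.eq_denoteHom {ι : convexSemilattices.termMonad ⟶ convMonad.{u}}
    (h : IsInduced ι) : ι = denoteHom := by
  have key : ∀ (X : Type u) (t : csSig.Term X), value ι t = value denoteHom t := by
    intro X t
    have h' := isInduced_denoteHom.{u}
    induction t using csTerm_induction with
    | var x => rw [h.var, h'.var]
    | oplus s t hs ht => rw [h.oplus, h'.oplus, hs, ht]
    | cplus p s t hs ht => rw [h.cplus, h'.cplus, hs, ht]
  refine MonadHom.ext' _ _ (funext fun X => ConcreteCategory.hom_ext _ _ fun c => ?_)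
  obtain ⟨t, rfl⟩ := convexSemilattices.exists_rep c
  exact ConvSet.ext (key X t)

instance isIso_denoteHom : IsIso denoteHom.{u} := by
  have happ : ∀ X, IsIso (((monadToFunctor (Type u)).map denoteHom.{u}).app X) := fun X =>
    (isIso_iff_bijective _).2 clsDenote_bijective
  have := NatIso.isIso_of_isIso_app ((monadToFunctor (Type u)).map denoteHom.{u})
  exact isIso_of_reflects_iso denoteHom.{u} (monadToFunctor (Type u))

end ConvPresentation

theorem mainTheorem2 :
    ConvPresentation.convexSemilattices.IsPresentationOf ConvPresentation.convMonad.{u} ∧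
    ∃ ι : ConvPresentation.convexSemilattices.termMonad ⟶ ConvPresentation.convMonad.{u},
      ConvPresentation.IsInduced ι ∧
      (∀ ι' : ConvPresentation.convexSemilattices.termMonad ⟶ ConvPresentation.convMonad.{u},
        ConvPresentation.IsInduced ι' → ι' = ι) ∧
      IsIso ι :=
  ⟨⟨asIso ConvPresentation.denoteHom⟩, ConvPresentation.denoteHom,
    ConvPresentation.isInduced_denoteHom, fun _ h => h.eq_denoteHom,
    ConvPresentation.isIso_denoteHom⟩
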